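/- Let $d\ge 1$ and $\sigma>0$, and let $y_j=\theta_j+\sigma\xi_j$, $j=1,\dots,d$, where $\theta=(\theta_1,\dots,\theta_d)\in\mathbb R^d$ is unknown and $\xi_1,\dots,\xi_d$ are i.i.d. standard normal random variables; write $\mathbf E_\theta$ for the expectation with respect to the law of $y=(y_1,\dots,y_d)$. Let $Q(\theta)=\sum_{i=1}^d\theta_i^2$ and, for $\Theta\subseteq\mathbb R^d$, let $$R^*_Q(\Theta)=\inf_{\hat T}\,\sup_{\theta\in\Theta}\mathbf E_\theta\big(\hat T-Q(\theta)\big)^2\in[0,\infty],$$ the infimum being over all estimators, i.e. all real-valued measurable functions $\hat T=\hat T(y)$ of the observations. Let $B_2(\kappa)=\{\theta\in\mathbb R^d:\|\theta\|_2\le\kappa\}$ and $B_0(s)=\{\theta\in\mathbb R^d:\theta\text{ has at most } s\text{ non-zero components}\}$. For integers $1\le s\le d$ put $$\bar\psi_\sigma(s,d)=\begin{cases}\sigma^4s^2\log^2(1+d/s^2) & \text{if } s<\sqrt d,\\ \sigma^4 d & \text{if } s\ge\sqrt d.\end{cases}$$ **Theorem.** There exists an absolute constant $c>0$ such that, for any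 integers $s,d$ satisfying $1\le s\le d$ and any $\kappa,\sigma>0$, $$R^*_Q\big(B_2(\kappa)\cap B_0(s)\big)\ \ge\ c\,\min\big\{\kappa^4,\ \max\{\sigma^2\kappa^2,\ \bar\psi_\sigma(s,d)\}\big\}.$$ Moreover, $R^*_Q(B_0(s))=\infty$ for any integers $1\le s\le d$ and any $\sigma>0$. -/

import Mathlib

open MeasureTheory ProbabilityTheory
open scoped ENNReal

namespace SparseSequence

/-- The law `P_θ` of the vector of observations `y_j = θ_j + σ ξ_j`, `j = 1, …, d`, where the
`ξ_j` are i.i.d. standard normal random variables. -/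
noncomputable def obsLaw {d : ℕ} (σ : ℝ) (θ : Fin d → ℝ) : Measure (Fin d → ℝ) :=
  (Measure.pi (fun _ : Fin d => gaussianReal 0 1)).map (fun ξ j => θ j + σ * ξ j)

/-- The maximum squared risk `sup_{θ ∈ Θ} E_θ (T̂ - T(θ))²` (possibly infinite) of an estimator
`T̂`, a function of the observations, of the functional `T` on the class `Θ`. -/
noncomputable def maxRisk {d : ℕ} (σ : ℝ) (T : (Fin d → ℝ) → ℝ) (Θ : Set (Fin d → ℝ))
    (That : (Fin d → ℝ) → ℝ) : ℝ≥0∞ :=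
  ⨆ θ ∈ Θ, ∫⁻ y, ENNReal.ofReal ((That y - T θ) ^ 2) ∂(obsLaw σ θ)

/-- The minimax risk `R*_T(Θ)`: the infimum of the maximum squared risk over all estimators,
that is, over all measurable functions of the observations. -/
noncomputable def minimaxSqRisk {d : ℕ} (σ : ℝ) (T : (Fin d → ℝ) → ℝ)
    (Θ : Set (Fin d → ℝ)) : ℝ≥0∞ :=
  ⨅ (That : (Fin d → ℝ) → ℝ) (_ : Measurable That), maxRisk σ T Θ That

/-- The quadratic functional `Q(θ) = ∑ θ_i²`. -/
def quadFunctional {d : ℕ} (θ : Fin d → ℝ) : ℝ := ∑ i, θ i ^ 2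

/-- The sparsity class `B_0(s)`: vectors with at most `s` non-zero components. -/
def sparseClass (d s : ℕ) : Set (Fin d → ℝ) := {θ | hammingNorm θ ≤ s}

/-- The Euclidean ball `B_2(κ)`: vectors with `‖θ‖₂ = √Q(θ) ≤ κ`. -/
def euclBall (d : ℕ) (κ : ℝ) : Set (Fin d → ℝ) := {θ | Real.sqrt (quadFunctional θ) ≤ κ}

/-- The rate `ψ̄_σ(s,d)`, with its sparse and dense zones. -/
noncomputable def psiBar (σ : ℝ) (s d : ℕ) : ℝ :=
  if (s : ℝ) < Real.sqrt (d : ℝ) then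
    σ ^ 4 * (s : ℝ) ^ 2 * Real.log (1 + (d : ℝ) / (s : ℝ) ^ 2) ^ 2
  else σ ^ 4 * (d : ℝ)

/-- The rate `ψ^Q_σ(s,d,κ) = min {κ⁴, max {σ²κ², ψ̄_σ(s,d)}}`. -/
noncomputable def psiQ (σ : ℝ) (s d : ℕ) (κ : ℝ) : ℝ :=
  min (κ ^ 4) (max (σ ^ 2 * κ ^ 2) (psiBar σ s d))

end SparseSequence

/-!
An estimator has to tell the origin of a least favourable configuration from a uniform mixture of
alternatives. If the mixture has likelihood ratio `L`, then the squared risk at one of the two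
hypotheses is at least a quarter of the squared separation of the functional times
`∫ min 1 L ≥ 1 / (1 + ∫ L²)`, and for Gaussian shifts by vectors `hᵢ` the second moment `∫ L²` is
the average of `exp ⟨hᵢ, hⱼ⟩`.

Two points at distance at most `σ` on a coordinate axis, at the boundary of the ball, give the rate
`min (κ⁴) (σ²κ²)`, and letting `κ → ∞` shows that the risk over the sparse class is infinite. For
the rate `ψ̄`, the coordinates are split into `m` blocks of `b ≈ d / m` coordinates, and the
mixture is over the vectors with exactly one entry `√r` in each block. The average of
`exp ⟨hᵢ, hⱼ⟩` is then `(1 + (exp r - 1) / b) ^ m`, which stays bounded as long as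
`r ≤ log (1 + d / m²)`. The dense zone is the case `m ≈ √d`.
-/

open scoped Finset

namespace SparseSequence

section LikelihoodRatio

variable {Ω : Type*} [MeasurableSpace Ω] {μ : Measure Ω} {L : Ω → ℝ≥0∞}

lemma two_mul_mul_le_sq_mul_min_one_add (a b : ℝ≥0∞) :
    2 * a * b ≤ a ^ 2 * min 1 b + (b + b ^ 2) := by
  rcases eq_or_ne b ⊤ with rfl | hb
  · simp
  rcases eq_or_ne a ⊤ with rfl | ha
  · rcases eq_or_ne b 0 with rfl | hb₀
    · simp
    · simp [ENNReal.top_mul, hb₀]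
  lift a to NNReal using ha
  lift b to NNReal using hb
  norm_cast
  rcases le_total b 1 with hb | hb
  · calc 2 * a * b = 2 * a * 1 * b := by ring
      _ ≤ (a ^ 2 + 1 ^ 2) * b := by gcongr; exact two_mul_le_add_sq a 1
      _ = a ^ 2 * min 1 b + b := by rw [min_eq_right hb]; ring
      _ ≤ a ^ 2 * min 1 b + (b + b ^ 2) := by gcongr; exact le_self_add
  · calc 2 * a * b ≤ a ^ 2 + b ^ 2 := two_mul_le_add_sq a b
      _ = a ^ 2 * min 1 b + b ^ 2 := by rw [min_eq_left hb, mul_one]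
      _ ≤ a ^ 2 * min 1 b + (b + b ^ 2) := by gcongr; exact le_add_self

lemma inv_one_add_lintegral_sq_le_lintegral_min_one (hL : Measurable L)
    (hL₁ : ∫⁻ x, L x ∂μ = 1) :
    (1 + ∫⁻ x, L x ^ 2 ∂μ)⁻¹ ≤ ∫⁻ x, min 1 (L x) ∂μ := by
  set a := 1 + ∫⁻ x, L x ^ 2 ∂μ with ha
  set A := ∫⁻ x, min 1 (L x) ∂μ
  rcases eq_or_ne a ⊤ with ha_top | ha_top
  · simp [ha_top]
  have ha₀ : a ≠ 0 := by simp [ha]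
  have hmin : Measurable fun x => min 1 (L x) := measurable_const.min hL
  have young : a + a ≤ a * a * A + a :=
    calc a + a = ∫⁻ x, 2 * a * L x ∂μ := by
          rw [lintegral_const_mul _ hL, hL₁, mul_one, two_mul]
      _ ≤ ∫⁻ x, (a ^ 2 * min 1 (L x) + (L x + L x ^ 2)) ∂μ :=
          lintegral_mono fun x => two_mul_mul_le_sq_mul_min_one_add a (L x)
      _ = a * a * A + a := by
          rw [lintegral_add_left (hmin.const_mul _), lintegral_const_mul _ hmin,
            lintegral_add_left hL, hL₁, sq]
  have one_le : 1 ≤ a * A := by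
    have h := ENNReal.le_of_add_le_add_right ha_top young
    rw [mul_assoc] at h
    rwa [← ENNReal.mul_le_mul_iff_right ha₀ ha_top, mul_one]
  exact (ENNReal.inv_le_iff_le_mul (by simp [ha₀]) (by simp [ha_top])).2 one_le

lemma ofReal_sq_sub_le (t q₀ q₁ : ℝ) :
    ENNReal.ofReal ((q₁ - q₀) ^ 2) ≤
      2 * (ENNReal.ofReal ((t - q₀) ^ 2) + ENNReal.ofReal ((t - q₁) ^ 2)) := by
  rw [← ENNReal.ofReal_add (sq_nonneg _) (sq_nonneg _), ← ENNReal.ofReal_ofNat 2,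
    ← ENNReal.ofReal_mul zero_le_two]
  exact ENNReal.ofReal_le_ofReal (by nlinarith [sq_nonneg ((t - q₀) + (t - q₁))])

lemma ofReal_sq_sub_mul_lintegral_min_one_le {t : Ω → ℝ} (ht : Measurable t) (q₀ q₁ : ℝ) :
    ENNReal.ofReal ((q₁ - q₀) ^ 2) * ∫⁻ x, min 1 (L x) ∂μ ≤
      2 * (∫⁻ x, ENNReal.ofReal ((t x - q₀) ^ 2) ∂μ +
        ∫⁻ x, L x * ENNReal.ofReal ((t x - q₁) ^ 2) ∂μ) := by
  have hloss : Measurable fun x => ENNReal.ofReal ((t x - q₀) ^ 2) := by fun_prop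
  rw [← lintegral_const_mul' _ _ ENNReal.ofReal_ne_top, ← lintegral_add_left hloss,
    ← lintegral_const_mul' _ _ ENNReal.ofNat_ne_top]
  refine lintegral_mono fun x => ?_
  calc ENNReal.ofReal ((q₁ - q₀) ^ 2) * min 1 (L x)
      ≤ 2 * (ENNReal.ofReal ((t x - q₀) ^ 2) + ENNReal.ofReal ((t x - q₁) ^ 2)) *
          min 1 (L x) := by gcongr; exact ofReal_sq_sub_le _ _ _
    _ = 2 * (min 1 (L x) * ENNReal.ofReal ((t x - q₀) ^ 2) +
          min 1 (L x) * ENNReal.ofReal ((t x - q₁) ^ 2)) := by ring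
    _ ≤ 2 * (1 * ENNReal.ofReal ((t x - q₀) ^ 2) + L x * ENNReal.ofReal ((t x - q₁) ^ 2)) := by
        gcongr
        · exact min_le_left _ _
        · exact min_le_right _ _
    _ = _ := by rw [one_mul]

lemma ofReal_sq_sub_div_le_of_lintegral_le (hL : Measurable L) (hL₁ : ∫⁻ x, L x ∂μ = 1)
    {t : Ω → ℝ} (ht : Measurable t) {q₀ q₁ : ℝ} {M : ℝ≥0∞}
    (h₀ : ∫⁻ x, ENNReal.ofReal ((t x - q₀) ^ 2) ∂μ ≤ M)
    (h₁ : ∫⁻ x, L x * ENNReal.ofReal ((t x - q₁) ^ 2) ∂μ ≤ M) :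
    ENNReal.ofReal ((q₁ - q₀) ^ 2) / (4 * (1 + ∫⁻ x, L x ^ 2 ∂μ)) ≤ M := by
  set a := 1 + ∫⁻ x, L x ^ 2 ∂μ
  have key : ENNReal.ofReal ((q₁ - q₀) ^ 2) * a⁻¹ ≤ M * 4 :=
    calc ENNReal.ofReal ((q₁ - q₀) ^ 2) * a⁻¹
        ≤ ENNReal.ofReal ((q₁ - q₀) ^ 2) * ∫⁻ x, min 1 (L x) ∂μ := by
          gcongr; exact inv_one_add_lintegral_sq_le_lintegral_min_one hL hL₁
      _ ≤ 2 * (M + M) :=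
          (ofReal_sq_sub_mul_lintegral_min_one_le ht q₀ q₁).trans (by gcongr)
      _ = M * 4 := by ring
  rw [div_eq_mul_inv, mul_comm 4 a,
    ENNReal.mul_inv (Or.inr ENNReal.ofNat_ne_top) (Or.inr four_ne_zero), ← mul_assoc,
    ← div_eq_mul_inv]
  exact ENNReal.div_le_of_le_mul key

end LikelihoodRatio

section GaussianShift

lemma lintegral_pi_prod {ι : Type*} [Fintype ι] {X : ι → Type*} [∀ i, MeasurableSpace (X i)]
    (μ : ∀ i, Measure (X i)) [∀ i, IsProbabilityMeasure (μ i)] {f : ∀ i, X i → ℝ≥0∞}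
    (hf : ∀ i, Measurable (f i)) :
    ∫⁻ x, ∏ i, f i (x i) ∂(Measure.pi μ) = ∏ i, ∫⁻ x, f i x ∂(μ i) := by
  have hindep : iIndepFun (fun i (x : ∀ i, X i) => f i (x i)) (Measure.pi μ) :=
    iIndepFun_pi fun i => (hf i).aemeasurable
  rw [lintegral_prod_eq_prod_lintegral_of_indepFun Finset.univ _ hindep
    fun i => (hf i).comp (measurable_pi_apply i)]
  exact Finset.prod_congr rfl fun i _ => (measurePreserving_eval μ i).lintegral_comp (hf i)

lemma pi_withDensity {ι : Type*} [Fintype ι] {X : ι → Type*} [∀ i, MeasurableSpace (X i)]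
    (μ : ∀ i, Measure (X i)) [∀ i, IsProbabilityMeasure (μ i)] {f : ∀ i, X i → ℝ≥0∞}
    (hf : ∀ i, Measurable (f i)) [∀ i, SigmaFinite ((μ i).withDensity (f i))] :
    Measure.pi (fun i => (μ i).withDensity (f i)) =
      (Measure.pi μ).withDensity fun x => ∏ i, f i (x i) := by
  refine Measure.pi_eq fun s hs => ?_
  have hind (x : ∀ i, X i) : (Set.univ.pi s).indicator (fun x => ∏ i, f i (x i)) x =
      ∏ i, (s i).indicator (f i) (x i) := by
    by_cases hx : x ∈ Set.univ.pi s
    · rw [Set.indicator_of_mem hx]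
      exact Finset.prod_congr rfl fun i _ => (Set.indicator_of_mem (hx i (Set.mem_univ i)) _).symm
    · rw [Set.indicator_of_notMem hx]
      simp only [Set.mem_univ_pi, not_forall] at hx
      obtain ⟨i, hi⟩ := hx
      exact (Finset.prod_eq_zero (Finset.mem_univ i) (Set.indicator_of_notMem hi _)).symm
  rw [withDensity_apply _ (MeasurableSet.univ_pi hs),
    ← lintegral_indicator (MeasurableSet.univ_pi hs)]
  simp_rw [hind]
  rw [lintegral_pi_prod μ fun i => (hf i).indicator (hs i)]
  exact Finset.prod_congr rfl fun i _ => by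
    rw [lintegral_indicator (hs i), withDensity_apply _ (hs i)]

lemma gaussianReal_eq_withDensity_gaussianReal_zero (m : ℝ) {v : NNReal} (hv : v ≠ 0) :
    gaussianReal m v = (gaussianReal 0 v).withDensity
      fun x => ENNReal.ofReal (Real.exp ((m * x - m ^ 2 / 2) / v)) := by
  rw [gaussianReal_of_var_ne_zero _ hv, gaussianReal_of_var_ne_zero _ hv,
    ← withDensity_mul _ (measurable_gaussianPDF _ _) (by fun_prop)]
  congr 1
  ext x
  simp only [gaussianPDF, Pi.mul_apply, gaussianPDFReal]
  rw [← ENNReal.ofReal_mul (by positivity), mul_assoc _ (Real.exp _), ← Real.exp_add]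
  congr 3
  have : (v : ℝ) ≠ 0 := NNReal.coe_ne_zero.2 hv
  field_simp
  ring

variable {α : Type*} [Fintype α]

/-- The law of a standard Gaussian vector with coordinates indexed by `α`, on the plain product
`α → ℝ` on which `obsLaw` lives (Mathlib's `stdGaussian` lives on an inner product space). -/
noncomputable abbrev stdGaussianPi (α : Type*) [Fintype α] : Measure (α → ℝ) :=
  Measure.pi fun _ : α => gaussianReal 0 1

/-- The likelihood ratio of the standard Gaussian law shifted by `h` with respect to the unshifted
one, given by the Cameron–Martin formula. -/
noncomputable def shiftDensity (h x : α → ℝ) : ℝ≥0∞ :=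
  ENNReal.ofReal (Real.exp (h ⬝ᵥ x - h ⬝ᵥ h / 2))

@[fun_prop]
lemma measurable_shiftDensity (h : α → ℝ) : Measurable (shiftDensity h) := by
  unfold shiftDensity dotProduct
  fun_prop

lemma shiftDensity_mul (h k x : α → ℝ) :
    shiftDensity h x * shiftDensity k x =
      ENNReal.ofReal (Real.exp (h ⬝ᵥ k)) * shiftDensity (h + k) x := by
  simp only [shiftDensity, ← ENNReal.ofReal_mul (Real.exp_pos _).le, ← Real.exp_add,
    add_dotProduct, dotProduct_add, dotProduct_comm k h]
  congr 2
  ring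

lemma shiftDensity_eq_prod (h x : α → ℝ) :
    shiftDensity h x =
      ∏ i, ENNReal.ofReal (Real.exp ((h i * x i - h i ^ 2 / 2) / (1 : NNReal))) := by
  rw [← ENNReal.ofReal_prod_of_nonneg fun i _ => (Real.exp_pos _).le, ← Real.exp_sum]
  simp only [shiftDensity, dotProduct, NNReal.coe_one, div_one, Finset.sum_sub_distrib,
    Finset.sum_div, sq]

theorem map_add_stdGaussianPi (h : α → ℝ) :
    (stdGaussianPi α).map (h + ·) = (stdGaussianPi α).withDensity (shiftDensity h) := by
  have hshift : (stdGaussianPi α).map (h + ·) = Measure.pi fun i => gaussianReal (h i) 1 := by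
    have := Measure.pi_map_pi (μ := fun _ : α => gaussianReal 0 1)
      (f := fun i (x : ℝ) => h i + x) (fun i => by fun_prop)
    simp only [gaussianReal_map_const_add, zero_add] at this
    exact this
  have hdens (i : α) := gaussianReal_eq_withDensity_gaussianReal_zero (h i) one_ne_zero
  have (i : α) : SigmaFinite ((gaussianReal 0 1).withDensity fun x =>
      ENNReal.ofReal (Real.exp ((h i * x - h i ^ 2 / 2) / (1 : NNReal)))) := by
    rw [← hdens]; infer_instance
  rw [hshift, funext hdens, pi_withDensity _ fun i => by fun_prop]
  simp_rw [← shiftDensity_eq_prod]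

lemma lintegral_shiftDensity (h : α → ℝ) : ∫⁻ x, shiftDensity h x ∂(stdGaussianPi α) = 1 := by
  rw [← setLIntegral_univ, ← withDensity_apply _ MeasurableSet.univ, ← map_add_stdGaussianPi,
    Measure.map_apply (by fun_prop) MeasurableSet.univ, Set.preimage_univ, measure_univ]

lemma lintegral_shiftDensity_mul (h k : α → ℝ) :
    ∫⁻ x, shiftDensity h x * shiftDensity k x ∂(stdGaussianPi α) =
      ENNReal.ofReal (Real.exp (h ⬝ᵥ k)) := by
  simp_rw [shiftDensity_mul]
  rw [lintegral_const_mul _ (measurable_shiftDensity _), lintegral_shiftDensity, mul_one]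

variable {ι : Type*} [Fintype ι]

/-- The likelihood ratio of the uniform mixture of the standard Gaussian laws shifted by the
vectors `h i`; it is the density of the composite hypothesis in the lower bound. -/
noncomputable def mixtureDensity (h : ι → α → ℝ) (x : α → ℝ) : ℝ≥0∞ :=
  (Fintype.card ι : ℝ≥0∞)⁻¹ * ∑ i, shiftDensity (h i) x

@[fun_prop]
lemma measurable_mixtureDensity (h : ι → α → ℝ) : Measurable (mixtureDensity h) := by
  unfold mixtureDensity
  fun_prop

lemma lintegral_mixtureDensity_mul (h : ι → α → ℝ) {F : (α → ℝ) → ℝ≥0∞} (hF : Measurable F) :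
    ∫⁻ x, mixtureDensity h x * F x ∂(stdGaussianPi α) =
      (Fintype.card ι : ℝ≥0∞)⁻¹ * ∑ i, ∫⁻ x, shiftDensity (h i) x * F x ∂(stdGaussianPi α) := by
  simp_rw [mixtureDensity, mul_assoc, Finset.sum_mul]
  rw [lintegral_const_mul _ (by fun_prop), lintegral_finsetSum _ fun i _ => by fun_prop]

lemma lintegral_mixtureDensity [Nonempty ι] (h : ι → α → ℝ) :
    ∫⁻ x, mixtureDensity h x ∂(stdGaussianPi α) = 1 := by
  have := lintegral_mixtureDensity_mul h (F := 1) measurable_one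
  simp only [Pi.one_apply, mul_one, lintegral_shiftDensity, Finset.sum_const, Finset.card_univ,
    nsmul_eq_mul] at this
  rw [this, ENNReal.inv_mul_cancel (by simp) (by simp)]

lemma lintegral_mixtureDensity_sq (h : ι → α → ℝ) :
    ∫⁻ x, mixtureDensity h x ^ 2 ∂(stdGaussianPi α) =
      (Fintype.card ι : ℝ≥0∞)⁻¹ *
        ((Fintype.card ι : ℝ≥0∞)⁻¹ * ∑ i, ∑ j, ENNReal.ofReal (Real.exp (h i ⬝ᵥ h j))) := by
  simp_rw [sq]
  rw [lintegral_mixtureDensity_mul h (measurable_mixtureDensity h)]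
  simp_rw [mul_comm (shiftDensity _ _),
    lintegral_mixtureDensity_mul h (measurable_shiftDensity _), lintegral_shiftDensity_mul,
    ← Finset.mul_sum, dotProduct_comm]

lemma lintegral_mixtureDensity_sq_le [Nonempty ι] (h : ι → α → ℝ) {C : ℝ}
    (hC : ∑ i, ∑ j, Real.exp (h i ⬝ᵥ h j) ≤ C * (Fintype.card ι : ℝ) ^ 2) :
    ∫⁻ x, mixtureDensity h x ^ 2 ∂(stdGaussianPi α) ≤ ENNReal.ofReal C := by
  have hcard : (0 : ℝ) < Fintype.card ι := by exact_mod_cast Fintype.card_pos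
  have hsum : ∑ i, ∑ j, ENNReal.ofReal (Real.exp (h i ⬝ᵥ h j)) =
      ENNReal.ofReal (∑ i, ∑ j, Real.exp (h i ⬝ᵥ h j)) := by
    rw [ENNReal.ofReal_sum_of_nonneg fun i _ => by positivity]
    exact Finset.sum_congr rfl fun i _ =>
      (ENNReal.ofReal_sum_of_nonneg fun j _ => by positivity).symm
  rw [lintegral_mixtureDensity_sq, hsum, ← ENNReal.ofReal_natCast,
    ← ENNReal.ofReal_inv_of_pos hcard, ← ENNReal.ofReal_mul (by positivity),
    ← ENNReal.ofReal_mul (by positivity)]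
  refine ENNReal.ofReal_le_ofReal ?_
  rwa [← mul_assoc, ← mul_inv, inv_mul_le_iff₀ (by positivity), ← sq, mul_comm _ C]

end GaussianShift

section MinimaxRisk

variable {d : ℕ} {σ : ℝ} {T : (Fin d → ℝ) → ℝ} {Θ : Set (Fin d → ℝ)} {θ₀ : Fin d → ℝ}

lemma lintegral_obsLaw (σ : ℝ) (θ : Fin d → ℝ) {F : (Fin d → ℝ) → ℝ≥0∞} (hF : Measurable F) :
    ∫⁻ y, F y ∂(obsLaw σ θ) = ∫⁻ x, F (θ + σ • x) ∂(stdGaussianPi (Fin d)) :=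
  lintegral_map hF (by fun_prop)

lemma lintegral_obsLaw_add_smul (σ : ℝ) (θ h : Fin d → ℝ) {F : (Fin d → ℝ) → ℝ≥0∞}
    (hF : Measurable F) :
    ∫⁻ y, F y ∂(obsLaw σ (θ + σ • h)) =
      ∫⁻ x, shiftDensity h x * F (θ + σ • x) ∂(stdGaussianPi (Fin d)) := by
  have hG : Measurable fun x : Fin d → ℝ => F (θ + σ • x) := hF.comp (by fun_prop)
  calc ∫⁻ y, F y ∂(obsLaw σ (θ + σ • h))
      = ∫⁻ x, F (θ + σ • (h + x)) ∂(stdGaussianPi (Fin d)) := by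
        simp_rw [lintegral_obsLaw _ _ hF, smul_add, add_assoc]
    _ = ∫⁻ x, F (θ + σ • x) ∂((stdGaussianPi (Fin d)).map (h + ·)) :=
        (lintegral_map hG (by fun_prop)).symm
    _ = _ := by
        rw [map_add_stdGaussianPi,
          lintegral_withDensity_eq_lintegral_mul _ (measurable_shiftDensity h) hG]
        rfl

lemma lintegral_le_maxRisk {That : (Fin d → ℝ) → ℝ} {θ : Fin d → ℝ} (hθ : θ ∈ Θ) :
    ∫⁻ y, ENNReal.ofReal ((That y - T θ) ^ 2) ∂(obsLaw σ θ) ≤ maxRisk σ T Θ That :=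
  le_iSup₂ (f := fun θ _ => ∫⁻ y, ENNReal.ofReal ((That y - T θ) ^ 2) ∂(obsLaw σ θ)) θ hθ

lemma minimaxSqRisk_mono {Θ' : Set (Fin d → ℝ)} (h : Θ ⊆ Θ') :
    minimaxSqRisk σ T Θ ≤ minimaxSqRisk σ T Θ' :=
  iInf₂_mono fun _ _ => biSup_mono fun _ hθ => h hθ

variable {ι : Type*} [Fintype ι] [Nonempty ι]

lemma lintegral_mixtureDensity_mul_le_maxRisk {h : ι → Fin d → ℝ}
    (hΘ : ∀ i, θ₀ + σ • h i ∈ Θ) {q : ℝ} (hq : ∀ i, T (θ₀ + σ • h i) = q)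
    {That : (Fin d → ℝ) → ℝ} (hThat : Measurable That) :
    ∫⁻ x, mixtureDensity h x * ENNReal.ofReal ((That (θ₀ + σ • x) - q) ^ 2)
      ∂(stdGaussianPi (Fin d)) ≤ maxRisk σ T Θ That := by
  have hloss : Measurable fun y => ENNReal.ofReal ((That y - q) ^ 2) := by fun_prop
  calc ∫⁻ x, mixtureDensity h x * ENNReal.ofReal ((That (θ₀ + σ • x) - q) ^ 2)
        ∂(stdGaussianPi (Fin d))
      = (Fintype.card ι : ℝ≥0∞)⁻¹ * ∑ i, ∫⁻ x, shiftDensity (h i) x *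
          ENNReal.ofReal ((That (θ₀ + σ • x) - q) ^ 2) ∂(stdGaussianPi (Fin d)) :=
        lintegral_mixtureDensity_mul h
          (hloss.comp (by fun_prop : Measurable fun x : Fin d → ℝ => θ₀ + σ • x))
    _ ≤ (Fintype.card ι : ℝ≥0∞)⁻¹ * ∑ _i : ι, maxRisk σ T Θ That := by
        gcongr with i
        rw [← lintegral_obsLaw_add_smul σ θ₀ (h i) hloss, ← hq i]
        exact lintegral_le_maxRisk (hΘ i)
    _ = maxRisk σ T Θ That := by
        rw [Finset.sum_const, Finset.card_univ, nsmul_eq_mul, ← mul_assoc,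
          ENNReal.inv_mul_cancel (by simp) (by simp), one_mul]

theorem ofReal_sq_div_le_minimaxSqRisk_of_mixture (hθ₀ : θ₀ ∈ Θ) {h : ι → Fin d → ℝ}
    (hΘ : ∀ i, θ₀ + σ • h i ∈ Θ) {q : ℝ} (hq : ∀ i, T (θ₀ + σ • h i) = q) {C : ℝ}
    (hC : ∑ i, ∑ j, Real.exp (h i ⬝ᵥ h j) ≤ C * (Fintype.card ι : ℝ) ^ 2) :
    ENNReal.ofReal ((q - T θ₀) ^ 2 / (4 * (1 + C))) ≤ minimaxSqRisk σ T Θ := by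
  have hC₀ : 0 < C :=
    pos_of_mul_pos_left (lt_of_lt_of_le (by positivity) hC) (by positivity)
  refine le_iInf₂ fun That hThat => ?_
  have hrisk₀ : ∫⁻ x, ENNReal.ofReal ((That (θ₀ + σ • x) - T θ₀) ^ 2)
      ∂(stdGaussianPi (Fin d)) ≤ maxRisk σ T Θ That := by
    rw [← lintegral_obsLaw σ θ₀ (F := fun y => ENNReal.ofReal ((That y - T θ₀) ^ 2)) (by fun_prop)]
    exact lintegral_le_maxRisk hθ₀
  refine le_trans ?_ (ofReal_sq_sub_div_le_of_lintegral_le (measurable_mixtureDensity h)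
    (lintegral_mixtureDensity h) (hThat.comp (by fun_prop)) hrisk₀
    (lintegral_mixtureDensity_mul_le_maxRisk hΘ hq hThat))
  rw [ENNReal.ofReal_div_of_pos (by positivity), ENNReal.ofReal_mul zero_le_four,
    ENNReal.ofReal_add zero_le_one hC₀.le, ENNReal.ofReal_ofNat, ENNReal.ofReal_one]
  gcongr
  exact lintegral_mixtureDensity_sq_le h hC

theorem ofReal_sq_div_le_minimaxSqRisk_of_pair (hθ₀ : θ₀ ∈ Θ) {h : Fin d → ℝ}
    (hΘ : θ₀ + σ • h ∈ Θ) :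
    ENNReal.ofReal ((T (θ₀ + σ • h) - T θ₀) ^ 2 / (4 * (1 + Real.exp (h ⬝ᵥ h)))) ≤
      minimaxSqRisk σ T Θ :=
  ofReal_sq_div_le_minimaxSqRisk_of_mixture (h := fun _ : Unit => h) hθ₀ (fun _ => hΘ)
    (fun _ => rfl) (by simp)

end MinimaxRisk

section Parametric

variable {d s : ℕ} {κ σ : ℝ}

lemma quadFunctional_eq_dotProduct (θ : Fin d → ℝ) : quadFunctional θ = θ ⬝ᵥ θ := by
  simp only [quadFunctional, dotProduct, sq]

lemma quadFunctional_single (i : Fin d) (a : ℝ) : quadFunctional (Pi.single i a) = a ^ 2 := by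
  rw [quadFunctional_eq_dotProduct, single_dotProduct, Pi.single_eq_same, sq]

lemma mem_euclBall_iff (hκ : 0 ≤ κ) {θ : Fin d → ℝ} :
    θ ∈ euclBall d κ ↔ quadFunctional θ ≤ κ ^ 2 :=
  Real.sqrt_le_left hκ

lemma single_mem_sparseClass (hs : 0 < s) (i : Fin d) (a : ℝ) :
    Pi.single i a ∈ sparseClass d s := by
  have hsupp : ({j | (Pi.single i a : Fin d → ℝ) j ≠ 0} : Finset (Fin d)) ⊆ {i} := fun j hj => by
    by_contra hne
    simp [Finset.mem_singleton.not.1 hne] at hj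
  exact (Finset.card_le_card hsupp).trans hs

lemma single_mem_euclBall_inter_sparseClass (hs : 0 < s) (i : Fin d) {a : ℝ} (ha : 0 ≤ a)
    (haκ : a ≤ κ) : Pi.single i a ∈ euclBall d κ ∩ sparseClass d s := by
  refine ⟨(mem_euclBall_iff (ha.trans haκ)).2 ?_, single_mem_sparseClass hs i a⟩
  rw [quadFunctional_single]
  gcongr

theorem ofReal_sq_mul_min_le_minimaxSqRisk (hs : 0 < s) (hd : 0 < d) (hκ : 0 < κ) (hσ : 0 < σ) :
    ENNReal.ofReal ((κ * min κ σ) ^ 2 / 16) ≤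
      minimaxSqRisk σ quadFunctional (euclBall d κ ∩ sparseClass d s) := by
  set t := min κ σ
  have ht : 0 < t := lt_min hκ hσ
  have htκ : t ≤ κ := min_le_left _ _
  let i : Fin d := ⟨0, hd⟩
  have hsum : (Pi.single i (κ - t) : Fin d → ℝ) + σ • Pi.single i (t / σ) = Pi.single i κ := by
    rw [← Pi.single_smul, ← Pi.single_add, smul_eq_mul, mul_div_cancel₀ t hσ.ne', sub_add_cancel]
  have hexp : Real.exp ((Pi.single i (t / σ) : Fin d → ℝ) ⬝ᵥ Pi.single i (t / σ)) ≤ 3 := by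
    rw [← quadFunctional_eq_dotProduct, quadFunctional_single]
    have : (t / σ) ^ 2 ≤ 1 := pow_le_one₀ (by positivity) ((div_le_one hσ).2 (min_le_right _ _))
    exact (Real.exp_le_exp.2 this).trans Real.exp_one_lt_three.le
  have hsep : κ * t ≤ κ ^ 2 - (κ - t) ^ 2 := by nlinarith
  refine le_trans (ENNReal.ofReal_le_ofReal ?_) (ofReal_sq_div_le_minimaxSqRisk_of_pair
    (single_mem_euclBall_inter_sparseClass hs i (sub_nonneg.2 htκ) (by linarith))
    (h := Pi.single i (t / σ))
    (hsum ▸ single_mem_euclBall_inter_sparseClass hs i hκ.le le_rfl))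
  rw [hsum, quadFunctional_single, quadFunctional_single]
  gcongr
  linarith

theorem minimaxSqRisk_sparseClass_eq_top (hs : 0 < s) (hd : 0 < d) (hσ : 0 < σ) :
    minimaxSqRisk σ quadFunctional (sparseClass d s) = ⊤ := by
  have hlower : ∀ᶠ κ in Filter.atTop, ENNReal.ofReal ((κ * σ) ^ 2 / 16) ≤
      minimaxSqRisk σ quadFunctional (sparseClass d s) := by
    filter_upwards [Filter.eventually_ge_atTop σ] with κ hκ
    have := ofReal_sq_mul_min_le_minimaxSqRisk hs hd (hσ.trans_le hκ) hσ
    rw [min_eq_right hκ] at this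
    exact this.trans (minimaxSqRisk_mono Set.inter_subset_right)
  have hlim : Filter.Tendsto (fun κ : ℝ => (κ * σ) ^ 2 / 16) Filter.atTop Filter.atTop :=
    ((Filter.tendsto_pow_atTop two_ne_zero).comp
      (Filter.tendsto_id.atTop_mul_const hσ)).atTop_div_const (by norm_num)
  exact top_le_iff.1 (le_of_tendsto (ENNReal.tendsto_ofReal_atTop.comp hlim) hlower)

end Parametric

section BlockVectors

variable {ι α β : Type*} [DecidableEq β]

/-- The vector with one entry `a` in each block and zeros elsewhere, the blocks being indexed by
`α` and laid out by `e`: the block `j` consists of the coordinates `e (j, k)`, and its non-zero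
entry sits at `k = f j`. These vectors are the alternatives of the sparse lower bound. -/
noncomputable def blockVec (e : α × β ↪ ι) (a : ℝ) (f : α → β) : ι → ℝ :=
  Function.extend e (fun p => if f p.1 = p.2 then a else 0) 0

lemma blockVec_apply (e : α × β ↪ ι) (a : ℝ) (f : α → β) (j : α) (k : β) :
    blockVec e a f (e (j, k)) = if f j = k then a else 0 :=
  e.injective.extend_apply _ _ _

lemma blockVec_eq_zero (e : α × β ↪ ι) (a : ℝ) {f : α → β} {i : ι} (hi : ∀ j, e (j, f j) ≠ i) :
    blockVec e a f i = 0 := by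
  by_cases he : ∃ p, e p = i
  · obtain ⟨⟨j, k⟩, rfl⟩ := he
    have hjk : f j ≠ k := by
      rintro rfl
      exact hi j rfl
    rw [blockVec_apply, if_neg hjk]
  · exact Function.extend_apply' _ _ _ he

variable [Fintype ι] [Fintype α]

lemma blockVec_dotProduct (e : α × β ↪ ι) (a : ℝ) (f : α → β) (v : ι → ℝ) :
    blockVec e a f ⬝ᵥ v = ∑ j, a * v (e (j, f j)) := by
  have hinj : Function.Injective fun j => e (j, f j) := fun j k hjk =>
    congrArg Prod.fst (e.injective hjk)
  refine (Fintype.sum_of_injective _ hinj _ _ (fun i hi => ?_) fun j => ?_).symm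
  · rw [blockVec_eq_zero e a fun j hj => hi ⟨j, hj⟩, zero_mul]
  · rw [blockVec_apply, if_pos rfl]

lemma blockVec_dotProduct_blockVec (e : α × β ↪ ι) (a : ℝ) (f g : α → β) :
    blockVec e a f ⬝ᵥ blockVec e a g = #{j | f j = g j} * a ^ 2 := by
  simp_rw [blockVec_dotProduct, blockVec_apply, mul_ite, mul_zero, ← Finset.sum_filter,
    Finset.sum_const, nsmul_eq_mul, eq_comm, sq]

lemma hammingNorm_blockVec_le (e : α × β ↪ ι) (a : ℝ) (f : α → β) :
    hammingNorm (blockVec e a f) ≤ Fintype.card α := by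
  classical
  have hsupp : ({i | blockVec e a f i ≠ 0} : Finset ι) ⊆
      Finset.univ.image fun j => e (j, f j) := fun i hi => by
    by_contra hne
    exact (Finset.mem_filter.1 hi).2 (blockVec_eq_zero e a (by simpa using hne))
  exact (Finset.card_le_card hsupp).trans Finset.card_image_le

variable [Fintype β] [DecidableEq α]

lemma sum_pow_card_agree {R : Type*} [CommRing R] (x : R) (f : α → β) :
    ∑ g : α → β, x ^ #{j | f j = g j} = (Fintype.card β + (x - 1)) ^ Fintype.card α := by
  have hblock (j : α) : ∑ k, (if f j = k then x else 1) = Fintype.card β + (x - 1) := by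
    have (k : β) : (if f j = k then x else 1) = 1 + if f j = k then x - 1 else 0 := by
      split_ifs <;> ring
    simp [this, Finset.sum_add_distrib]
  simp_rw [← Finset.prod_const, Finset.prod_filter]
  rw [← Fintype.prod_sum fun j k => if f j = k then x else 1]
  simp [hblock]

lemma sum_exp_blockVec_dotProduct_le [Nonempty β] (e : α × β ↪ ι) (a : ℝ) :
    ∑ f, ∑ g, Real.exp (blockVec e a f ⬝ᵥ blockVec e a g) ≤
      Real.exp (Fintype.card α * ((Real.exp (a ^ 2) - 1) / Fintype.card β)) *
        (Fintype.card (α → β) : ℝ) ^ 2 := by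
  set b : ℝ := (Fintype.card β : ℝ)
  have hb : 0 < b := Nat.cast_pos.2 Fintype.card_pos
  set y := Real.exp (a ^ 2) - 1
  have hy : 0 ≤ y := sub_nonneg.2 (Real.one_le_exp (sq_nonneg a))
  have hbase : b + y ≤ b * Real.exp (y / b) :=
    calc b + y = b * (y / b + 1) := by field_simp; ring
      _ ≤ b * Real.exp (y / b) := by gcongr; exact Real.add_one_le_exp _
  calc ∑ f, ∑ g, Real.exp (blockVec e a f ⬝ᵥ blockVec e a g)
      = b ^ Fintype.card α * (b + y) ^ Fintype.card α := by
        simp_rw [blockVec_dotProduct_blockVec, Real.exp_nat_mul,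
          sum_pow_card_agree]
        simp [b, y]
    _ ≤ b ^ Fintype.card α * (b * Real.exp (y / b)) ^ Fintype.card α := by gcongr
    _ = Real.exp (Fintype.card α * (y / b)) * (Fintype.card (α → β) : ℝ) ^ 2 := by
        rw [Real.exp_nat_mul, Fintype.card_fun, Nat.cast_pow]
        ring

end BlockVectors

section Sparse

variable {m s d : ℕ} {κ σ : ℝ}

lemma cast_div_cast_le_two_mul_cast_div (hm : 0 < m) (hmd : m ≤ d) :
    (d : ℝ) / m ≤ 2 * (d / m : ℕ) := by
  have hmod := Nat.div_add_mod d m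
  have hlt := Nat.mod_lt d hm
  have hle : m ≤ m * (d / m) := Nat.le_mul_of_pos_right _ (Nat.div_pos hmd hm)
  rw [div_le_iff₀ (by exact_mod_cast hm)]
  exact_mod_cast (by linarith : d ≤ 2 * (d / m) * m)

lemma exp_two_le_eight : Real.exp 2 ≤ 8 := by
  calc Real.exp 2 = Real.exp 1 * Real.exp 1 := by rw [← Real.exp_add]; norm_num
    _ ≤ 2.8 * 2.8 := by gcongr <;> linarith [Real.exp_one_lt_d9]
    _ ≤ 8 := by norm_num

variable {α β : Type*} [Fintype α] [DecidableEq β]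

lemma quadFunctional_smul_blockVec (σ : ℝ) (e : α × β ↪ Fin d) (a : ℝ) (f : α → β) :
    quadFunctional (σ • blockVec e a f) = σ ^ 2 * (Fintype.card α * a ^ 2) := by
  rw [quadFunctional_eq_dotProduct, smul_dotProduct, dotProduct_smul, blockVec_dotProduct_blockVec]
  simp only [Finset.filter_true, Finset.card_univ, smul_eq_mul]
  ring

lemma smul_blockVec_mem_euclBall_inter_sparseClass (hκ : 0 ≤ κ) (e : α × β ↪ Fin d) {a : ℝ}
    (hs : Fintype.card α ≤ s) (ha : σ ^ 2 * (Fintype.card α * a ^ 2) ≤ κ ^ 2) (f : α → β) :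
    σ • blockVec e a f ∈ euclBall d κ ∩ sparseClass d s :=
  ⟨(mem_euclBall_iff hκ).2 ((quadFunctional_smul_blockVec σ e a f).trans_le ha),
    hammingNorm_smul_le_hammingNorm.trans ((hammingNorm_blockVec_le e a f).trans hs)⟩

lemma ofReal_sq_le_minimaxSqRisk_of_exp_le (hm : 0 < m) (hms : m ≤ s) (hmd : m ≤ d) (hκ : 0 ≤ κ)
    {a : ℝ} (haκ : σ ^ 2 * (m * a ^ 2) ≤ κ ^ 2)
    (hexp : Real.exp (a ^ 2) ≤ 1 + d / (m : ℝ) ^ 2) :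
    ENNReal.ofReal ((σ ^ 2 * (m * a ^ 2)) ^ 2 / 36) ≤
      minimaxSqRisk σ quadFunctional (euclBall d κ ∩ sparseClass d s) := by
  have hb : 0 < d / m := Nat.div_pos hmd hm
  have : Nonempty (Fin (d / m)) := ⟨⟨0, hb⟩⟩
  obtain ⟨e⟩ : Nonempty (Fin m × Fin (d / m) ↪ Fin d) :=
    Function.Embedding.nonempty_of_card_le (by simpa using Nat.mul_div_le d m)
  have hQ₀ : quadFunctional (0 : Fin d → ℝ) = 0 := by simp [quadFunctional]
  have hmem₀ : (0 : Fin d → ℝ) ∈ euclBall d κ ∩ sparseClass d s :=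
    ⟨(mem_euclBall_iff hκ).2 (by rw [hQ₀]; positivity), by simp [sparseClass]⟩
  have hmem (f : Fin m → Fin (d / m)) :
      0 + σ • blockVec e a f ∈ euclBall d κ ∩ sparseClass d s := by
    rw [zero_add]
    exact smul_blockVec_mem_euclBall_inter_sparseClass hκ e (by simpa using hms)
      (by simpa using haκ) f
  have hQ (f : Fin m → Fin (d / m)) : quadFunctional (0 + σ • blockVec e a f) =
      σ ^ 2 * (m * a ^ 2) := by
    rw [zero_add, quadFunctional_smul_blockVec, Fintype.card_fin]
  have hχ : Real.exp (Fintype.card (Fin m) *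
      ((Real.exp (a ^ 2) - 1) / Fintype.card (Fin (d / m)))) ≤ 8 := by
    refine (Real.exp_le_exp.2 ?_).trans exp_two_le_eight
    rw [Fintype.card_fin, Fintype.card_fin, mul_div_assoc', div_le_iff₀ (by exact_mod_cast hb)]
    calc (m : ℝ) * (Real.exp (a ^ 2) - 1) ≤ m * (d / (m : ℝ) ^ 2) := by gcongr; linarith
      _ = d / m := by field_simp
      _ ≤ 2 * (d / m : ℕ) := cast_div_cast_le_two_mul_cast_div hm hmd
  have key := ofReal_sq_div_le_minimaxSqRisk_of_mixture hmem₀ hmem hQ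
    ((sum_exp_blockVec_dotProduct_le e a).trans (mul_le_mul_of_nonneg_right hχ (sq_nonneg _)))
  rwa [hQ₀, sub_zero, show (4 : ℝ) * (1 + 8) = 36 by norm_num] at key

theorem ofReal_min_sq_le_minimaxSqRisk (hm : 0 < m) (hms : m ≤ s) (hmd : m ≤ d) (hκ : 0 ≤ κ)
    (hσ : 0 < σ) :
    ENNReal.ofReal
        (min (κ ^ 2) (σ ^ 2 * m * Real.log (1 + (d : ℝ) / (m : ℝ) ^ 2)) ^ 2 / 36) ≤
      minimaxSqRisk σ quadFunctional (euclBall d κ ∩ sparseClass d s) := by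
  set ℓ := Real.log (1 + (d : ℝ) / (m : ℝ) ^ 2)
  have hℓ : 0 ≤ ℓ := Real.log_nonneg (le_add_of_nonneg_right (by positivity))
  set r := min (κ ^ 2 / (σ ^ 2 * m)) ℓ
  have hr : √r ^ 2 = r := Real.sq_sqrt (le_min (by positivity) hℓ)
  have hσr : σ ^ 2 * (m * √r ^ 2) = min (κ ^ 2) (σ ^ 2 * m * ℓ) := by
    rw [hr, ← mul_assoc, mul_min_of_nonneg _ _ (by positivity),
      mul_div_cancel₀ _ (by positivity)]
  have hexp : Real.exp (√r ^ 2) ≤ 1 + d / (m : ℝ) ^ 2 := by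
    rw [hr]
    exact (Real.le_log_iff_exp_le (by positivity)).1 (min_le_right _ _)
  rw [← hσr]
  exact ofReal_sq_le_minimaxSqRisk_of_exp_le hm hms hmd hκ (hσr.trans_le (min_le_left _ _)) hexp

end Sparse

section Rate

variable {s d : ℕ} {κ σ : ℝ}

lemma one_half_le_log_of_two_le {x : ℝ} (hx : 2 ≤ x) : 1 / 2 ≤ Real.log x := by
  have := Real.log_le_log two_pos hx
  linarith [Real.log_two_gt_d9]

lemma exists_psiBar_le (hs : 0 < s) (hd : 0 < d) (σ : ℝ) :
    ∃ m : ℕ, 0 < m ∧ m ≤ s ∧ m ≤ d ∧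
      psiBar σ s d ≤ (4 * (σ ^ 2 * m * Real.log (1 + (d : ℝ) / (m : ℝ) ^ 2))) ^ 2 := by
  by_cases hsparse : (s : ℝ) < √d
  · have hsd : s ^ 2 ≤ d := by exact_mod_cast (Real.lt_sqrt (by positivity)).1 hsparse |>.le
    refine ⟨s, hs, le_rfl, (Nat.le_self_pow two_ne_zero s).trans hsd, ?_⟩
    rw [psiBar, if_pos hsparse]
    nlinarith [sq_nonneg (σ ^ 2 * s * Real.log (1 + (d : ℝ) / (s : ℝ) ^ 2))]
  · set m := Nat.sqrt d
    have hm : 0 < m := Nat.sqrt_pos.2 hd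
    have hms : (m : ℝ) ≤ s := Real.nat_sqrt_le_real_sqrt.trans (not_lt.1 hsparse)
    refine ⟨m, hm, by exact_mod_cast hms, Nat.sqrt_le_self d, ?_⟩
    have hm' : (1 : ℝ) ≤ m := by exact_mod_cast hm
    have hmd : (m : ℝ) ^ 2 ≤ d := by exact_mod_cast Nat.sqrt_le' d
    have hdm : (d : ℝ) < (m + 1) ^ 2 := by exact_mod_cast Nat.lt_succ_sqrt' d
    have hlog : 1 / 2 ≤ Real.log (1 + (d : ℝ) / (m : ℝ) ^ 2) :=
      one_half_le_log_of_two_le (by linarith [(one_le_div (by positivity)).2 hmd])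
    calc psiBar σ s d = σ ^ 4 * d := by rw [psiBar, if_neg hsparse]
      _ ≤ σ ^ 4 * (2 * m) ^ 2 := by gcongr; nlinarith
      _ = (4 * (σ ^ 2 * m * (1 / 2))) ^ 2 := by ring
      _ ≤ _ := by gcongr

lemma min_sq_le_sq_min (x y : ℝ) : min (x ^ 2) (y ^ 2) ≤ min x y ^ 2 := by
  rcases min_choice x y with h | h <;> simp [h]

theorem ofReal_psiQ_le_minimaxSqRisk (hs : 0 < s) (hd : 0 < d) (hκ : 0 < κ) (hσ : 0 < σ) :
    ENNReal.ofReal (1 / 576 * psiQ σ s d κ) ≤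
      minimaxSqRisk σ quadFunctional (euclBall d κ ∩ sparseClass d s) := by
  rw [psiQ]
  rcases le_total (psiBar σ s d) (σ ^ 2 * κ ^ 2) with h | h
  · rw [max_eq_left h]
    refine (ENNReal.ofReal_le_ofReal ?_).trans (ofReal_sq_mul_min_le_minimaxSqRisk hs hd hκ hσ)
    have hmin : min (κ ^ 4) (σ ^ 2 * κ ^ 2) ≤ (κ * min κ σ) ^ 2 := by
      convert min_sq_le_sq_min (κ * κ) (κ * σ) using 1
      · congr 1 <;> ring
      · rw [mul_min_of_nonneg _ _ hκ.le]
    linarith [sq_nonneg (κ * min κ σ)]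
  · rw [max_eq_right h]
    obtain ⟨m, hm, hms, hmd, hψ⟩ := exists_psiBar_le hs hd σ
    refine (ENNReal.ofReal_le_ofReal ?_).trans
      (ofReal_min_sq_le_minimaxSqRisk hm hms hmd hκ.le hσ)
    set ρ := σ ^ 2 * m * Real.log (1 + (d : ℝ) / (m : ℝ) ^ 2)
    have hmin : min (κ ^ 4) (psiBar σ s d) ≤ 16 * min (κ ^ 2) ρ ^ 2 :=
      calc min (κ ^ 4) (psiBar σ s d) ≤ min (16 * (κ ^ 2) ^ 2) (16 * ρ ^ 2) :=
            min_le_min (by nlinarith [sq_nonneg (κ ^ 2)]) (hψ.trans_eq (by ring))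
        _ = 16 * min ((κ ^ 2) ^ 2) (ρ ^ 2) := (mul_min_of_nonneg _ _ (by norm_num)).symm
        _ ≤ 16 * min (κ ^ 2) ρ ^ 2 := by gcongr; exact min_sq_le_sq_min _ _
    linarith

end Rate

end SparseSequence

theorem theorem3 :
    (∃ c : ℝ, 0 < c ∧ ∀ s d : ℕ, 1 ≤ s → s ≤ d → ∀ κ σ : ℝ, 0 < κ → 0 < σ →
      ENNReal.ofReal (c * SparseSequence.psiQ σ s d κ) ≤
        SparseSequence.minimaxSqRisk σ SparseSequence.quadFunctional
          (SparseSequence.euclBall d κ ∩ SparseSequence.sparseClass d s)) ∧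
    (∀ s d : ℕ, 1 ≤ s → s ≤ d → ∀ σ : ℝ, 0 < σ →
      SparseSequence.minimaxSqRisk σ SparseSequence.quadFunctional
        (SparseSequence.sparseClass d s) = ⊤) :=
  ⟨⟨1 / 576, by norm_num, fun _ _ hs hsd _ _ hκ hσ =>
      SparseSequence.ofReal_psiQ_le_minimaxSqRisk hs (hs.trans hsd) hκ hσ⟩,
    fun _ _ hs hsd _ hσ =>
      SparseSequence.minimaxSqRisk_sparseClass_eq_top hs (hs.trans hsd) hσ⟩
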